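/- Let $\nu,\sigma>0$, and let $\beta_1,\gamma_1,\beta_2,\gamma_2,\dots$ be mutually independent real random variables on a probability space such that every $\beta_k$ is exponentially distributed with rate $\nu$ (mean $1/\nu$) and every $\gamma_k$ is exponentially distributed with rate $\sigma$ (mean $1/\sigma$). Consider the stochastic dynamical system $z(k)=A(k)z(k-1)$, $k\ge 1$, with $$A(k)=\begin{pmatrix}0&\beta_k\\ \gamma_k&0\end{pmatrix},\qquad z(k)=\begin{pmatrix}x(k)\\ y(k)\end{pmatrix},\qquad z(0)=\begin{pmatrix}0\\0\end{pmatrix},$$ where the matrix-vector product is taken over the semiring with maximum as addition and $+$ as multiplication, and the entries $0$ are the real number $0$; that is, $$x(k)=\max\bigl(x(k-1),\,y(k-1)+\beta_k\bigr),\qquad y(k)=\max\bigl(x(k-1)+\gamma_k,\,y(k-1)\bigr).$$ Then the Lyapunov exponent $\lambda=\lim_{k\to\infty}\frac1k\max\bigl(x(k),y(k)\bigr)$ exists almost surely and is given by $$\lambda=\frac{4\nu^2+7\nu\sigma+4\sigma^2}{6\nu\sigma(\nu+\sigma)}.$$ -/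

import Mathlib

open MeasureTheory ProbabilityTheory Filter Topology

/-- The matrix-vector product over the semiring `(ℝ, max, +)` in dimension two. -/
def maxPlusMulVec (A : Matrix (Fin 2) (Fin 2) ℝ) (z : Fin 2 → ℝ) : Fin 2 → ℝ :=
  fun i => max (z 0 + A i 0) (z 1 + A i 1)

/-- The trajectory of `z(k) = A(k) z(k-1)`, `z(0) = (0, 0)`, over the semiring `(ℝ, max, +)`.
The matrices are indexed from zero: the transition matrix of step `k + 1` is `A k`. -/
def maxPlusState (A : ℕ → Matrix (Fin 2) (Fin 2) ℝ) : ℕ → Fin 2 → ℝ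
  | 0 => ![0, 0]
  | k + 1 => maxPlusMulVec (A k) (maxPlusState A k)

/-- `l` is the Lyapunov exponent of the random max-plus system with transition matrices `A k`:
almost surely `max (x(k), y(k)) / k` tends to `l`, where `z(k) = (x(k), y(k))`. -/
def IsLyapunovExponent {Ω : Type*} [MeasurableSpace Ω] (P : Measure Ω)
    (A : ℕ → Ω → Matrix (Fin 2) (Fin 2) ℝ) (l : ℝ) : Prop :=
  ∀ᵐ ω ∂P, Tendsto
    (fun k : ℕ => (1 / (k : ℝ)) *
      max (maxPlusState (fun n => A n ω) k 0) (maxPlusState (fun n => A n ω) k 1))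
    atTop (𝓝 l)

/-! Write `D = x - y`. If `D = d ≥ 0`, a step adds `d' = max (β - d) 0` to `x` and makes the new
difference `d' - γ`. By memorylessness of the exponential law, `d'` is a mixture of a fresh
exponential variable and `0` with weights `exp (-ν d)` and `1 - exp (-ν d)`, so the expected growth
depends on the past only through `exp (-ν d)`. Hence the Poisson equation `E V(z(1)) = V(z(0)) + λ`
has a solution `V = max x y - g D` with `g` bounded, affine in `exp (-ν D)` for `D ≥ 0` and in
`exp (σ D)` for `D ≤ 0`.

Consequently `V(z(n)) - n λ` is a martingale `M n`. Its increments are orthogonal with bounded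
second moments, so the mean of `(M (n²) / n²)²` is `O(1 / n²)` and `M (n²) / n² → 0` almost surely.
After adding the partial sums of an i.i.d. sequence `M` is monotone, which fills the gaps between
consecutive squares.
-/

section RandomRecursion

variable {S E Ω : Type*} {f : S → E → S} {z₀ : S} {V : S → ℝ} {l : ℝ}

/-- The orbit of `z₀` under the recursion `z (n + 1) = f (z n) (w n)` driven by the noise `w`. -/
def orbit (f : S → E → S) (z₀ : S) (w : ℕ → E) : ℕ → S
  | 0 => z₀
  | n + 1 => f (orbit f z₀ w n) (w n)

/-- The increment of `V` in one step of the recursion, less its mean `l`. -/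
def centredIncrement (f : S → E → S) (V : S → ℝ) (l : ℝ) (z : S) (p : E) : ℝ :=
  V (f z p) - V z - l

/-- The centred potential `V (z n) - V z₀ - n l` along an orbit, a martingale when `V` solves the
Poisson equation with constant `l` and the noise is independent. -/
def centredPotential (f : S → E → S) (V : S → ℝ) (l : ℝ) (z₀ : S) (w : ℕ → E) (n : ℕ) : ℝ :=
  V (orbit f z₀ w n) - V z₀ - n * l

lemma centredPotential_succ (w : ℕ → E) (n : ℕ) :
    centredPotential f V l z₀ w (n + 1) = centredPotential f V l z₀ w n +
      centredIncrement f V l (orbit f z₀ w n) (w n) := by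
  simp only [centredPotential, centredIncrement, orbit]
  push_cast
  ring

variable [MeasurableSpace S] [MeasurableSpace E] [MeasurableSpace Ω]

lemma exists_measurable_orbit_eq (hf : Measurable (Function.uncurry f)) (n : ℕ) :
    ∃ φ : (Finset.range n → E) → S, Measurable φ ∧ ∀ w, orbit f z₀ w n = φ (fun i => w i) := by
  induction n with
  | zero => exact ⟨fun _ => z₀, measurable_const, fun _ => rfl⟩
  | succ n ih =>
    obtain ⟨φ, hφ, hφw⟩ := ih
    let past (v : Finset.range (n + 1) → E) : Finset.range n → E :=
      fun i => v ⟨i, Finset.range_mono n.le_succ i.2⟩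
    refine ⟨fun v => f (φ (past v)) (v ⟨n, Finset.self_mem_range_succ n⟩),
      hf.comp (Measurable.prodMk (hφ.comp ?_) (measurable_pi_apply _)), fun w => ?_⟩
    · exact measurable_pi_lambda _ fun i => measurable_pi_apply _
    · simp only [orbit, hφw, past]

/-- `V` solves the Poisson equation `∫ V (f z p) dμ(p) = V z + l` of the recursion `z ↦ f z p`
whose noise `p` has law `μ`, with increments controlled by a square-integrable function `B` of the
noise alone. -/
structure IsPoissonSolution (f : S → E → S) (μ : Measure E) (V : S → ℝ) (l : ℝ) (B : E → ℝ) :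
    Prop where
  measurable : Measurable V
  memLp_bound : MemLp B 2 μ
  abs_centredIncrement_le : ∀ z p, |centredIncrement f V l z p| ≤ B p
  integral_eq : ∀ z, ∫ p, V (f z p) ∂μ = V z + l

variable {P : Measure Ω} {μ : Measure E} {ξ : ℕ → Ω → E} {B : E → ℝ}

lemma measurable_centredIncrement (hV : Measurable V) (hf : Measurable (Function.uncurry f)) :
    Measurable fun q : S × E => centredIncrement f V l q.1 q.2 :=
  ((hV.comp hf).sub (hV.comp measurable_fst)).sub_const l

lemma integral_centredIncrement_eq_zero [IsProbabilityMeasure μ]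
    (hV : IsPoissonSolution f μ V l B) (hf : Measurable (Function.uncurry f)) (z : S) :
    ∫ p, centredIncrement f V l z p ∂μ = 0 := by
  have hincrement : Integrable (centredIncrement f V l z) μ :=
    (hV.memLp_bound.integrable one_le_two).mono'
      ((measurable_centredIncrement hV.measurable hf).comp
        measurable_prodMk_left).aestronglyMeasurable
      (ae_of_all _ fun p => hV.abs_centredIncrement_le z p)
  have hsum : ∀ p, V (f z p) = centredIncrement f V l z p + (V z + l) := fun p => by
    simp only [centredIncrement]
    ring
  have h := hV.integral_eq z
  simp only [hsum] at h
  rw [integral_add hincrement (integrable_const _), integral_const, probReal_univ, one_smul] at h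
  linarith

lemma aemeasurable_orbit (hf : Measurable (Function.uncurry f)) (hξ : ∀ n, AEMeasurable (ξ n) P)
    (n : ℕ) : AEMeasurable (fun ω => orbit f z₀ (ξ · ω) n) P := by
  obtain ⟨φ, hφ, hφw⟩ := exists_measurable_orbit_eq (z₀ := z₀) hf n
  simp only [hφw]
  exact hφ.comp_aemeasurable (aemeasurable_pi_lambda _ fun i => hξ i)

lemma indepFun_orbit (hf : Measurable (Function.uncurry f)) {n : ℕ}
    (hind : IndepFun (fun ω (i : Finset.range n) => ξ i ω) (ξ n) P) :
    IndepFun (fun ω => orbit f z₀ (ξ · ω) n) (ξ n) P := by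
  obtain ⟨φ, hφ, hφw⟩ := exists_measurable_orbit_eq (z₀ := z₀) hf n
  simp only [hφw]
  exact hind.comp hφ measurable_id

lemma pairwise_indepFun_of_past
    (hind : ∀ n, IndepFun (fun ω (i : Finset.range n) => ξ i ω) (ξ n) P) :
    Pairwise (Function.onFun (IndepFun · · P) ξ) := by
  have hlt : ∀ i j, i < j → IndepFun (ξ i) (ξ j) P := fun i j hij =>
    (hind j).comp (measurable_pi_apply (⟨i, Finset.mem_range.2 hij⟩ : Finset.range j))
      measurable_id
  intro i j hij
  rcases hij.lt_or_gt with h | h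
  · exact hlt i j h
  · exact (hlt j i h).symm

lemma memLp_comp_of_hasLaw {g : E → ℝ} {X : Ω → E} {p : ENNReal} (hg : MemLp g p μ)
    (hX : HasLaw X μ P) : MemLp (fun ω => g (X ω)) p P :=
  MemLp.comp_of_map (hX.map_eq.symm ▸ hg) hX.aemeasurable

lemma integral_mul_eq_zero_of_indepFun [IsFiniteMeasure P] [SFinite μ] {Z : Ω → S} {X : Ω → E}
    {W : S → ℝ} {G : S × E → ℝ} (hZ : AEMeasurable Z P) (hX : HasLaw X μ P)
    (hind : IndepFun Z X P) (hW : Measurable W) (hG : Measurable G)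
    (hG0 : ∀ z, ∫ p, G (z, p) ∂μ = 0)
    (hWG : Integrable (fun ω => W (Z ω) * G (Z ω, X ω)) P) :
    ∫ ω, W (Z ω) * G (Z ω, X ω) ∂P = 0 := by
  have hlaw : HasLaw (fun ω => (Z ω, X ω)) ((P.map Z).prod μ) P :=
    IndepFun.hasLaw_prod ⟨hZ, rfl⟩ hX hind
  have hmeas : Measurable fun q : S × E => W q.1 * G q := (hW.comp measurable_fst).mul hG
  calc ∫ ω, W (Z ω) * G (Z ω, X ω) ∂P
      = ∫ q, W q.1 * G q ∂((P.map Z).prod μ) :=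
        hlaw.integral_comp hmeas.aestronglyMeasurable
    _ = ∫ z, W z * ∫ p, G (z, p) ∂μ ∂(P.map Z) := by
        rw [integral_prod]
        · simp only [integral_const_mul]
        · rw [← hlaw.map_eq, integrable_map_measure hmeas.aestronglyMeasurable hlaw.aemeasurable]
          exact hWG
    _ = 0 := by simp only [hG0, mul_zero, integral_zero]

section Moments

variable (hV : IsPoissonSolution f μ V l B) (hf : Measurable (Function.uncurry f))
  (hξ : ∀ n, HasLaw (ξ n) μ P)

include hV hf hξ

lemma memLp_centredIncrement (n : ℕ) :
    MemLp (fun ω => centredIncrement f V l (orbit f z₀ (ξ · ω) n) (ξ n ω)) 2 P := by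
  refine (memLp_comp_of_hasLaw hV.memLp_bound (hξ n)).mono' ?_
    (ae_of_all _ fun ω => hV.abs_centredIncrement_le _ _)
  exact ((measurable_centredIncrement hV.measurable hf).comp_aemeasurable
    ((aemeasurable_orbit hf (fun n => (hξ n).aemeasurable) n).prodMk
      (hξ n).aemeasurable)).aestronglyMeasurable

lemma memLp_centredPotential (n : ℕ) :
    MemLp (fun ω => centredPotential f V l z₀ (ξ · ω) n) 2 P := by
  induction n with
  | zero => simp [centredPotential, orbit]
  | succ n ih =>
    simp only [centredPotential_succ]
    exact ih.add (memLp_centredIncrement hV hf hξ n)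

lemma integral_centredPotential_mul_centredIncrement [IsProbabilityMeasure P] {n : ℕ}
    (hind : IndepFun (fun ω (i : Finset.range n) => ξ i ω) (ξ n) P) :
    ∫ ω, centredPotential f V l z₀ (ξ · ω) n *
      centredIncrement f V l (orbit f z₀ (ξ · ω) n) (ξ n ω) ∂P = 0 := by
  have : IsProbabilityMeasure μ := (hξ n).isProbabilityMeasure_iff.1 ‹_›
  exact integral_mul_eq_zero_of_indepFun (W := fun z => V z - V z₀ - n * l)
    (aemeasurable_orbit hf (fun n => (hξ n).aemeasurable) n) (hξ n) (indepFun_orbit hf hind)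
    ((hV.measurable.sub_const _).sub_const _) (measurable_centredIncrement hV.measurable hf)
    (integral_centredIncrement_eq_zero hV hf)
    ((memLp_centredPotential hV hf hξ n).integrable_mul (memLp_centredIncrement hV hf hξ n))

/-- Orthogonality of martingale increments makes the second moments add up. -/
lemma integral_sq_centredPotential_le [IsProbabilityMeasure P]
    (hind : ∀ n, IndepFun (fun ω (i : Finset.range n) => ξ i ω) (ξ n) P) (n : ℕ) :
    ∫ ω, centredPotential f V l z₀ (ξ · ω) n ^ 2 ∂P ≤ n * ∫ p, B p ^ 2 ∂μ := by
  induction n with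
  | zero => simp [centredPotential, orbit]
  | succ n ih =>
    set M := fun ω => centredPotential f V l z₀ (ξ · ω) n
    set D := fun ω => centredIncrement f V l (orbit f z₀ (ξ · ω) n) (ξ n ω)
    have hM : MemLp M 2 P := memLp_centredPotential hV hf hξ n
    have hD : MemLp D 2 P := memLp_centredIncrement hV hf hξ n
    have hMD : Integrable (fun ω => M ω * D ω) P := hM.integrable_mul hD
    have hD_le : ∫ ω, D ω ^ 2 ∂P ≤ ∫ p, B p ^ 2 ∂μ := by
      have hB := memLp_comp_of_hasLaw hV.memLp_bound (hξ n)
      calc ∫ ω, D ω ^ 2 ∂P ≤ ∫ ω, B (ξ n ω) ^ 2 ∂P :=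
            integral_mono hD.integrable_sq hB.integrable_sq fun ω =>
              sq_le_sq' (neg_le_of_abs_le (hV.abs_centredIncrement_le _ _))
                (le_of_abs_le (hV.abs_centredIncrement_le _ _))
        _ = ∫ p, B p ^ 2 ∂μ :=
            (hξ n).integral_comp (f := fun p => B p ^ 2)
              (hV.memLp_bound.aestronglyMeasurable.pow 2)
    calc ∫ ω, centredPotential f V l z₀ (ξ · ω) (n + 1) ^ 2 ∂P
        = ∫ ω, (M ω ^ 2 + 2 * (M ω * D ω) + D ω ^ 2) ∂P := by
          simp only [centredPotential_succ, add_sq, mul_assoc, M, D]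
      _ = ∫ ω, M ω ^ 2 ∂P + 2 * ∫ ω, M ω * D ω ∂P + ∫ ω, D ω ^ 2 ∂P := by
          have hadd := hM.integrable_sq.add (hMD.const_mul 2)
          simp only [Pi.add_def] at hadd
          rw [integral_add hadd hD.integrable_sq,
            integral_add hM.integrable_sq (hMD.const_mul 2), integral_const_mul]
      _ ≤ n * ∫ p, B p ^ 2 ∂μ + 2 * 0 + ∫ p, B p ^ 2 ∂μ := by
          rw [integral_centredPotential_mul_centredIncrement hV hf hξ (hind n)]
          gcongr
      _ = (n + 1 : ℕ) * ∫ p, B p ^ 2 ∂μ := by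
          push_cast
          ring

end Moments

lemma ae_tendsto_div_sq_of_integral_sq_le {X : ℕ → Ω → ℝ} {K : ℝ} (hX : ∀ n, MemLp (X n) 2 P)
    (hK : ∀ n, ∫ ω, X n ω ^ 2 ∂P ≤ n * K) :
    ∀ᵐ ω ∂P, Tendsto (fun n : ℕ => X (n ^ 2) ω / (n ^ 2 : ℕ)) atTop (𝓝 0) := by
  let Y (n : ℕ) (ω : Ω) : ℝ := (X (n ^ 2) ω / (n ^ 2 : ℕ)) ^ 2
  have hY (n : ℕ) : MemLp (Y n) 1 P := by
    simp only [Y, div_eq_mul_inv, mul_pow]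
    exact memLp_one_iff_integrable.2 ((hX (n ^ 2)).integrable_sq.mul_const _)
  have hle (n : ℕ) : eLpNorm (Y n) 1 P ≤ ENNReal.ofReal (K * (1 / (n : ℝ) ^ 2)) := by
    rw [eLpNorm_one_eq_lintegral_enorm, ← ofReal_integral_norm_eq_lintegral_enorm
      (memLp_one_iff_integrable.1 (hY n))]
    refine ENNReal.ofReal_le_ofReal ?_
    calc ∫ ω, ‖Y n ω‖ ∂P = (∫ ω, X (n ^ 2) ω ^ 2 ∂P) / ((n ^ 2 : ℕ) : ℝ) ^ 2 := by
          simp only [Y, div_pow, norm_div, norm_pow, Real.norm_eq_abs, sq_abs]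
          exact integral_div _ _
      _ ≤ (n ^ 2 : ℕ) * K / ((n ^ 2 : ℕ) : ℝ) ^ 2 := by
          gcongr
          exact hK _
      _ = K * (1 / (n : ℝ) ^ 2) := by
          rcases eq_or_ne n 0 with rfl | hn
          · simp
          · push_cast
            field_simp
  have hsum : ∑' n, eLpNorm (Y n) 1 P ≠ ⊤ :=
    ne_top_of_le_ne_top
      ((Real.summable_one_div_nat_pow.2 one_lt_two).mul_left K).tsum_ofReal_ne_top
      (ENNReal.tsum_le_tsum hle)
  filter_upwards [summable_norm_of_tsum_eLpNorm_ne_top le_rfl (fun n => (hY n).1) hsum] with ω hω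
  have hsq : Tendsto (fun n => Y n ω) atTop (𝓝 0) :=
    tendsto_zero_iff_norm_tendsto_zero.2 hω.tendsto_atTop_zero
  have habs := hsq.sqrt
  simp only [Y, Real.sqrt_sq_eq_abs, Real.sqrt_zero] at habs
  exact (tendsto_zero_iff_abs_tendsto_zero _).2 habs

lemma tendsto_div_of_monotone_of_tendsto_div_sq {u : ℕ → ℝ} {l : ℝ} (hu : Monotone u)
    (h : Tendsto (fun n : ℕ => u (n ^ 2) / (n ^ 2 : ℕ)) atTop (𝓝 l)) :
    Tendsto (fun n : ℕ => u n / n) atTop (𝓝 l) := by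
  refine tendsto_div_of_monotone_of_exists_subseq_tendsto_div u l hu fun a ha =>
    ⟨fun n => n ^ 2, ?_, tendsto_pow_atTop two_ne_zero, h⟩
  have hlim : Tendsto (fun n : ℕ => (1 + 1 / (n : ℝ)) ^ 2) atTop (𝓝 1) := by
    simpa using (tendsto_one_div_atTop_nhds_zero_nat (𝕜 := ℝ)).const_add 1 |>.pow 2
  filter_upwards [hlim.eventually_lt_const ha, eventually_gt_atTop 0] with n hn hn0
  have hratio : (((n + 1) ^ 2 : ℕ) : ℝ) = (1 + 1 / (n : ℝ)) ^ 2 * (n ^ 2 : ℕ) := by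
    push_cast
    field_simp
  rw [hratio]
  gcongr

/-- Adding the partial sums of `b`, which obey their own law of large numbers, makes `x`
monotone. -/
lemma tendsto_div_of_tendsto_div_sq {x b : ℕ → ℝ} {m : ℝ} (hxb : ∀ n, x n - b n ≤ x (n + 1))
    (hb : Tendsto (fun n : ℕ => (∑ i ∈ Finset.range n, b i) / n) atTop (𝓝 m))
    (hx : Tendsto (fun n : ℕ => x (n ^ 2) / (n ^ 2 : ℕ)) atTop (𝓝 0)) :
    Tendsto (fun n : ℕ => x n / n) atTop (𝓝 0) := by
  let u (n : ℕ) : ℝ := x n + ∑ i ∈ Finset.range n, b i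
  have hu : Monotone u := monotone_nat_of_le_succ fun n => by
    simp only [u, Finset.sum_range_succ]
    linarith [hxb n]
  have hu_sq : Tendsto (fun n : ℕ => u (n ^ 2) / (n ^ 2 : ℕ)) atTop (𝓝 m) := by
    simpa only [u, add_div, zero_add, Function.comp_def] using
      hx.add (hb.comp (tendsto_pow_atTop two_ne_zero))
  simpa only [u, add_div, add_sub_cancel_right, sub_self] using
    (tendsto_div_of_monotone_of_tendsto_div_sq hu hu_sq).sub hb

theorem ae_tendsto_div_of_isPoissonSolution [IsProbabilityMeasure P]
    (hV : IsPoissonSolution f μ V l B) (hf : Measurable (Function.uncurry f))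
    (hξ : ∀ n, HasLaw (ξ n) μ P)
    (hind : ∀ n, IndepFun (fun ω (i : Finset.range n) => ξ i ω) (ξ n) P) :
    ∀ᵐ ω ∂P, Tendsto (fun n : ℕ => V (orbit f z₀ (ξ · ω) n) / n) atTop (𝓝 l) := by
  have hB (i : ℕ) : AEMeasurable B (P.map (ξ i)) :=
    (hξ i).map_eq ▸ hV.memLp_bound.aestronglyMeasurable.aemeasurable
  have hslln := strong_law_ae_real (fun n ω => B (ξ n ω))
    ((memLp_comp_of_hasLaw hV.memLp_bound (hξ 0)).integrable one_le_two)
    (fun i j hij => (pairwise_indepFun_of_past hind hij).comp₀ (hξ i).aemeasurable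
      (hξ j).aemeasurable (hB i) (hB j))
    (fun i => ((hξ i).identDistrib (hξ 0)).comp_of_aemeasurable (hB i))
  have hsq := ae_tendsto_div_sq_of_integral_sq_le (memLp_centredPotential (z₀ := z₀) hV hf hξ)
    (integral_sq_centredPotential_le hV hf hξ hind)
  filter_upwards [hslln, hsq] with ω hsum hsq
  have hM : Tendsto (fun n : ℕ => centredPotential f V l z₀ (ξ · ω) n / n) atTop (𝓝 0) := by
    refine tendsto_div_of_tendsto_div_sq (fun n => ?_) hsum hsq
    rw [centredPotential_succ]
    linarith [neg_le_of_abs_le (hV.abs_centredIncrement_le (orbit f z₀ (ξ · ω) n) (ξ n ω))]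
  have hsplit : ∀ᶠ n : ℕ in atTop, centredPotential f V l z₀ (ξ · ω) n / n + V z₀ / n + l =
      V (orbit f z₀ (ξ · ω) n) / n := by
    filter_upwards [eventually_ne_atTop 0] with n hn
    simp only [centredPotential]
    field_simp
    ring
  simpa using ((hM.add (tendsto_const_div_atTop_nhds_zero_nat (V z₀))).add_const l).congr' hsplit

end RandomRecursion

section Mixture

variable {α : Type*} [MeasurableSpace α] {μ : Measure α} {F : α → ℝ} {a b : ℝ} {x : α}

lemma integrable_ofReal_smul_add_dirac (hF : Integrable F μ) (hFm : StronglyMeasurable F) :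
    Integrable F (ENNReal.ofReal a • μ + ENNReal.ofReal b • Measure.dirac x) :=
  (hF.smul_measure ENNReal.ofReal_ne_top).add_measure
    ((integrable_dirac' hFm (by simp)).smul_measure ENNReal.ofReal_ne_top)

lemma integral_ofReal_smul_add_dirac (hF : Integrable F μ) (hFm : StronglyMeasurable F)
    (ha : 0 ≤ a) (hb : 0 ≤ b) :
    ∫ y, F y ∂(ENNReal.ofReal a • μ + ENNReal.ofReal b • Measure.dirac x) =
      a * ∫ y, F y ∂μ + b * F x := by
  rw [integral_add_measure (hF.smul_measure ENNReal.ofReal_ne_top)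
    ((integrable_dirac' hFm (by simp)).smul_measure ENNReal.ofReal_ne_top), integral_smul_measure,
    integral_smul_measure, integral_dirac' _ _ hFm, ENNReal.toReal_ofReal ha,
    ENNReal.toReal_ofReal hb, smul_eq_mul, smul_eq_mul]

end Mixture

section ExponentialLaw

lemma expMeasure_eq_withDensity (r : ℝ) :
    expMeasure r = (volume.restrict (Set.Ioi 0)).withDensity
      (fun x => ENNReal.ofReal (r * Real.exp (-(r * x)))) := by
  rw [expMeasure, gammaMeasure, ← withDensity_indicator measurableSet_Ioi]
  refine withDensity_congr_ae ?_
  filter_upwards [Measure.ae_ne volume (0 : ℝ)] with x hx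
  rcases hx.lt_or_gt with h | h
  · rw [gammaPDF_of_neg h, Set.indicator_of_notMem (by simpa using h.le)]
  · rw [gammaPDF_of_nonneg h.le, Set.indicator_of_mem (by simpa using h)]
    simp

lemma ae_pos_expMeasure (r : ℝ) : ∀ᵐ x ∂(expMeasure r), 0 < x := by
  rw [expMeasure_eq_withDensity]
  exact (withDensity_absolutelyContinuous _ _).ae_le (ae_restrict_mem measurableSet_Ioi)

section Moments

variable {r : ℝ} (hr : 0 < r)

include hr

lemma integral_expMeasure (f : ℝ → ℝ) :
    ∫ x, f x ∂(expMeasure r) = ∫ x in Set.Ioi 0, r * Real.exp (-(r * x)) * f x := by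
  rw [expMeasure_eq_withDensity, integral_withDensity_eq_integral_toReal_smul (by fun_prop)
    (by simp)]
  refine integral_congr_ae (ae_of_all _ fun x => ?_)
  simp only [smul_eq_mul]
  rw [ENNReal.toReal_ofReal (by positivity)]

lemma integrable_expMeasure_iff (f : ℝ → ℝ) :
    Integrable f (expMeasure r) ↔
      IntegrableOn (fun x => r * Real.exp (-(r * x)) * f x) (Set.Ioi 0) := by
  rw [expMeasure_eq_withDensity, integrable_withDensity_iff_integrable_smul' (by fun_prop)
    (by simp), IntegrableOn]
  refine integrable_congr (ae_of_all _ fun x => ?_)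
  simp only [smul_eq_mul]
  rw [ENNReal.toReal_ofReal (by positivity)]

omit hr in
lemma exp_density_mul_exp_neg_mul (r s x : ℝ) :
    r * Real.exp (-(r * x)) * Real.exp (-(s * x)) = r * Real.exp (-(r + s) * x) := by
  rw [mul_assoc, ← Real.exp_add]
  ring_nf

lemma integrable_exp_neg_mul_expMeasure {s : ℝ} (hrs : 0 < r + s) :
    Integrable (fun x => Real.exp (-(s * x))) (expMeasure r) := by
  simp only [integrable_expMeasure_iff hr, exp_density_mul_exp_neg_mul]
  exact (integrableOn_exp_mul_Ioi (neg_lt_zero.2 hrs) 0).const_mul r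

lemma integral_exp_neg_mul_expMeasure {s : ℝ} (hrs : 0 < r + s) :
    ∫ x, Real.exp (-(s * x)) ∂(expMeasure r) = r / (r + s) := by
  simp only [integral_expMeasure hr, exp_density_mul_exp_neg_mul]
  rw [integral_const_mul, integral_exp_mul_Ioi (neg_lt_zero.2 hrs), mul_zero, Real.exp_zero]
  field_simp

lemma integral_one_sub_exp_neg_mul_expMeasure {s : ℝ} (hrs : 0 < r + s) :
    ∫ x, (1 - Real.exp (-(s * x))) ∂(expMeasure r) = s / (r + s) := by
  have := isProbabilityMeasure_expMeasure hr
  rw [integral_sub (integrable_const 1) (integrable_exp_neg_mul_expMeasure hr hrs),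
    integral_exp_neg_mul_expMeasure hr hrs, integral_const, probReal_univ, one_smul]
  field_simp
  ring

lemma integral_id_expMeasure : ∫ x, x ∂(expMeasure r) = 1 / r := by
  have hGamma := Real.integral_rpow_mul_exp_neg_mul_Ioi (a := 2) two_pos hr
  norm_num at hGamma
  rw [integral_expMeasure hr]
  simp only [mul_assoc, integral_const_mul, mul_comm (Real.exp _), hGamma]
  field_simp

lemma memLp_id_expMeasure : MemLp (fun x : ℝ => x) 2 (expMeasure r) := by
  rw [memLp_two_iff_integrable_sq (by fun_prop), integrable_expMeasure_iff hr]
  have hrpow := (integrableOn_rpow_mul_exp_neg_mul_rpow (p := 1) (s := 2) (by norm_num) one_pos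
    hr).const_mul r
  refine IntegrableOn.congr_fun hrpow (fun x _ => ?_) measurableSet_Ioi
  simp only [Real.rpow_one, Real.rpow_two, neg_mul]
  ring

lemma integrable_id_expMeasure : Integrable (fun x : ℝ => x) (expMeasure r) :=
  have := isProbabilityMeasure_expMeasure hr
  (memLp_id_expMeasure hr).integrable one_le_two

theorem map_posPart_sub_expMeasure {a : ℝ} (ha : 0 ≤ a) :
    (expMeasure r).map (fun x => max (x - a) 0) =
      ENNReal.ofReal (Real.exp (-(r * a))) • expMeasure r +
        ENNReal.ofReal (1 - Real.exp (-(r * a))) • Measure.dirac 0 := by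
  have := isProbabilityMeasure_expMeasure hr
  have hIic (x : ℝ) : expMeasure r (Set.Iic x) =
      ENNReal.ofReal (if 0 ≤ x then 1 - Real.exp (-(r * x)) else 0) := by
    rw [← cdf_expMeasure_eq hr, ofReal_cdf]
  have hexp : Real.exp (-(r * a)) ≤ 1 := by simpa using mul_nonneg hr.le ha
  refine Measure.ext_of_Iic _ _ fun t => ?_
  rw [Measure.map_apply (by fun_prop) measurableSet_Iic]
  simp only [Measure.add_apply, Measure.smul_apply, smul_eq_mul, hIic]
  rw [Measure.dirac_apply' _ measurableSet_Iic]
  rcases le_or_gt 0 t with ht | ht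
  · have hpre : (fun x => max (x - a) 0) ⁻¹' Set.Iic t = Set.Iic (t + a) := by
      ext x
      simp [ht]
    have hexp_t : Real.exp (-(r * t)) ≤ 1 := by simpa using mul_nonneg hr.le ht
    rw [hpre, hIic, if_pos (add_nonneg ht ha), if_pos ht, Set.indicator_of_mem (by simpa using ht),
      Pi.one_apply, mul_one, ← ENNReal.ofReal_mul (Real.exp_nonneg _), ← ENNReal.ofReal_add]
    · rw [mul_add, neg_add, Real.exp_add]
      ring_nf
    · exact mul_nonneg (Real.exp_nonneg _) (sub_nonneg.2 hexp_t)
    · exact sub_nonneg.2 hexp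
  · have hpre : (fun x => max (x - a) 0) ⁻¹' Set.Iic t = ∅ := by
      ext x
      simp [ht]
    rw [hpre, if_neg ht.not_ge, Set.indicator_of_notMem (by simpa using ht)]
    simp

end Moments

theorem map_posPart_sub_prod_expMeasure {r s : ℝ} (hr : 0 < r) (hs : 0 < s) :
    ((expMeasure r).prod (expMeasure s)).map (fun p => max (p.1 - p.2) 0) =
      ENNReal.ofReal (s / (r + s)) • expMeasure r +
        ENNReal.ofReal (r / (r + s)) • Measure.dirac 0 := by
  have := isProbabilityMeasure_expMeasure hr
  have := isProbabilityMeasure_expMeasure hs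
  have hmeas : Measurable fun p : ℝ × ℝ => max (p.1 - p.2) 0 := by fun_prop
  ext t ht
  have hslice : ∀ᵐ q ∂(expMeasure s),
      expMeasure r ((fun p => (p, q)) ⁻¹' ((fun p : ℝ × ℝ => max (p.1 - p.2) 0) ⁻¹' t)) =
        ENNReal.ofReal (Real.exp (-(r * q))) * expMeasure r t +
          ENNReal.ofReal (1 - Real.exp (-(r * q))) * Measure.dirac 0 t := by
    filter_upwards [ae_pos_expMeasure s] with q hq
    have h := congrArg (· t) (map_posPart_sub_expMeasure hr hq.le)
    rwa [Measure.map_apply (by fun_prop) ht] at h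
  have hexp := integrable_exp_neg_mul_expMeasure hs (add_pos hs hr)
  have hone_sub : Integrable (fun q => 1 - Real.exp (-(r * q))) (expMeasure s) :=
    (integrable_const 1).sub hexp
  have hone_sub_nonneg : 0 ≤ᵐ[expMeasure s] fun q => 1 - Real.exp (-(r * q)) := by
    filter_upwards [ae_pos_expMeasure s] with q hq
    simpa using (mul_pos hr hq).le
  rw [Measure.map_apply hmeas ht, Measure.prod_apply_symm (hmeas ht), lintegral_congr_ae hslice,
    lintegral_add_left (by fun_prop), lintegral_mul_const _ (by fun_prop),
    lintegral_mul_const _ (by fun_prop),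
    ← ofReal_integral_eq_lintegral_ofReal hexp (ae_of_all _ fun q => Real.exp_nonneg _),
    ← ofReal_integral_eq_lintegral_ofReal hone_sub hone_sub_nonneg,
    integral_one_sub_exp_neg_mul_expMeasure hs (add_pos hs hr),
    integral_exp_neg_mul_expMeasure hs (add_pos hs hr), add_comm s r]
  simp

section PosPart

variable {r s : ℝ} {F : ℝ → ℝ} (hr : 0 < r) (hF : Integrable F (expMeasure r))
  (hFm : StronglyMeasurable F)

include hr hF hFm

lemma integral_posPart_sub_expMeasure {a : ℝ} (ha : 0 ≤ a) :
    ∫ x, F (max (x - a) 0) ∂(expMeasure r) =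
      Real.exp (-(r * a)) * ∫ x, F x ∂(expMeasure r) + (1 - Real.exp (-(r * a))) * F 0 := by
  rw [← integral_map (φ := fun x => max (x - a) 0) (by fun_prop) hFm.aestronglyMeasurable,
    map_posPart_sub_expMeasure hr ha, integral_ofReal_smul_add_dirac hF hFm (Real.exp_nonneg _)]
  simpa using mul_nonneg hr.le ha

lemma integrable_posPart_sub_prod_expMeasure (hs : 0 < s) :
    Integrable (fun p : ℝ × ℝ => F (max (p.1 - p.2) 0)) ((expMeasure r).prod (expMeasure s)) := by
  refine Integrable.comp_measurable (f := fun p : ℝ × ℝ => max (p.1 - p.2) 0) ?_ (by fun_prop)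
  rw [map_posPart_sub_prod_expMeasure hr hs]
  exact integrable_ofReal_smul_add_dirac hF hFm

lemma integral_posPart_sub_prod_expMeasure (hs : 0 < s) :
    ∫ p, F (max (p.1 - p.2) 0) ∂((expMeasure r).prod (expMeasure s)) =
      s / (r + s) * ∫ x, F x ∂(expMeasure r) + r / (r + s) * F 0 := by
  rw [← integral_map (φ := fun p : ℝ × ℝ => max (p.1 - p.2) 0) (by fun_prop)
    hFm.aestronglyMeasurable, map_posPart_sub_prod_expMeasure hr hs,
    integral_ofReal_smul_add_dirac hF hFm (by positivity) (by positivity)]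

end PosPart

end ExponentialLaw

section Potential

variable {ν σ : ℝ}

/-- The growth rate of the system with exponential noises of rates `ν` and `σ`. -/
noncomputable def growthRate (ν σ : ℝ) : ℝ :=
  (4 * ν ^ 2 + 7 * ν * σ + 4 * σ ^ 2) / (6 * ν * σ * (ν + σ))

/-- The limit at infinity of `discount ν σ`. The numbers `discountLimit ν σ`, `discountLimit σ ν`
and `growthRate ν σ` solve the linear system to which the Poisson equation reduces: see
`integral_potential` and `integral_potential_zero_left`. -/
noncomputable def discountLimit (ν σ : ℝ) : ℝ :=
  (ν + 2 * σ) / (3 * ν * (ν + σ))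

/-- The amount by which a lead `t` of the first coordinate over the second reduces the potential of
the system with noises of rates `ν` and `σ`; there is no reduction for `t ≤ 0`. -/
noncomputable def discount (ν σ t : ℝ) : ℝ :=
  discountLimit ν σ * (1 - Real.exp (-(ν * max t 0)))

/-- The explicit solution of the Poisson equation of the system with exponential noises of rates
`ν` and `σ`: the larger coordinate, less a bounded function of the difference. -/
noncomputable def potential (ν σ x y : ℝ) : ℝ :=
  max x y - discount ν σ (x - y) - discount σ ν (y - x)

lemma growthRate_comm (ν σ : ℝ) : growthRate ν σ = growthRate σ ν := by
  simp only [growthRate]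
  ring_nf

lemma potential_swap (ν σ x y : ℝ) : potential ν σ x y = potential σ ν y x := by
  simp only [potential, max_comm x y]
  ring

lemma potential_add_add (ν σ c x y : ℝ) :
    potential ν σ (c + x) (c + y) = c + potential ν σ x y := by
  simp only [potential, max_add_add_left, add_sub_add_left_eq_sub]
  ring

lemma discount_of_nonneg {t : ℝ} (ht : 0 ≤ t) :
    discount ν σ t = discountLimit ν σ * (1 - Real.exp (-(ν * t))) := by
  rw [discount, max_eq_left ht]

lemma discount_of_nonpos {t : ℝ} (ht : t ≤ 0) : discount ν σ t = 0 := by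
  simp [discount, ht]

lemma discount_posPart (ν σ t : ℝ) : discount ν σ (max t 0) = discount ν σ t := by
  simp [discount]

lemma continuous_discount (ν σ : ℝ) : Continuous (discount ν σ) := by
  unfold discount
  fun_prop

lemma continuous_potential (ν σ : ℝ) : Continuous fun p : ℝ × ℝ => potential ν σ p.1 p.2 := by
  have h₁ := continuous_discount ν σ
  have h₂ := continuous_discount σ ν
  unfold potential
  fun_prop

variable (hν : 0 < ν) (hσ : 0 < σ)

include hν hσ

lemma discountLimit_nonneg : 0 ≤ discountLimit ν σ := by
  unfold discountLimit
  positivity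

lemma discount_mem_Icc (t : ℝ) : discount ν σ t ∈ Set.Icc 0 (discountLimit ν σ) := by
  have hexp : Real.exp (-(ν * max t 0)) ≤ 1 := by simpa using mul_nonneg hν.le (le_max_right t 0)
  exact ⟨mul_nonneg (discountLimit_nonneg hν hσ) (sub_nonneg.2 hexp),
    mul_le_of_le_one_right (discountLimit_nonneg hν hσ) (sub_le_self 1 (Real.exp_nonneg _))⟩

lemma max_sub_potential_mem_Icc (x y : ℝ) :
    max x y - potential ν σ x y ∈ Set.Icc 0 (discountLimit ν σ + discountLimit σ ν) := by
  obtain ⟨h₁, h₂⟩ := discount_mem_Icc hν hσ (x - y)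
  obtain ⟨h₃, h₄⟩ := discount_mem_Icc hσ hν (y - x)
  constructor <;> simp only [potential] <;> linarith

section Integrable

variable {α : Type*} [MeasurableSpace α] {μ : Measure α} [IsFiniteMeasure μ] {X Y : α → ℝ}

lemma integrable_discount (hX : AEMeasurable X μ) :
    Integrable (fun a => discount ν σ (X a)) μ := by
  refine Integrable.of_bound
    ((continuous_discount ν σ).measurable.comp_aemeasurable hX).aestronglyMeasurable
    (discountLimit ν σ) (ae_of_all _ fun a => ?_)
  obtain ⟨h₀, h₁⟩ := discount_mem_Icc hν hσ (X a)
  rwa [Real.norm_of_nonneg h₀]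

lemma integrable_potential (hX : Integrable X μ) (hY : Integrable Y μ) :
    Integrable (fun a => potential ν σ (X a) (Y a)) μ :=
  ((hX.sup hY).sub (integrable_discount hν hσ (hX.aemeasurable.sub hY.aemeasurable))).sub
    (integrable_discount hσ hν (hY.aemeasurable.sub hX.aemeasurable))

end Integrable

omit hσ in
lemma integral_discount : ∫ x, discount ν σ x ∂(expMeasure ν) = discountLimit ν σ / 2 := by
  have hpos : ∀ᵐ x ∂(expMeasure ν), discount ν σ x =
      discountLimit ν σ * (1 - Real.exp (-(ν * x))) := by
    filter_upwards [ae_pos_expMeasure ν] with x hx using discount_of_nonneg hx.le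
  rw [integral_congr_ae hpos, integral_const_mul,
    integral_one_sub_exp_neg_mul_expMeasure hν (add_pos hν hν)]
  field_simp
  ring

lemma integral_discount_sub :
    ∫ p, discount ν σ (p.1 - p.2) ∂((expMeasure ν).prod (expMeasure σ)) =
      σ / (ν + σ) * (discountLimit ν σ / 2) := by
  have := isProbabilityMeasure_expMeasure hν
  have h := integral_posPart_sub_prod_expMeasure hν
    (integrable_discount hν hσ (μ := expMeasure ν) aemeasurable_id')
    (continuous_discount ν σ).stronglyMeasurable hσ
  simpa only [discount_posPart, integral_discount hν, discount_of_nonpos le_rfl, mul_zero,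
    add_zero] using h

lemma integral_discount_swap_sub :
    ∫ p, discount σ ν (p.2 - p.1) ∂((expMeasure ν).prod (expMeasure σ)) =
      ν / (ν + σ) * (discountLimit σ ν / 2) := by
  have := isProbabilityMeasure_expMeasure hν
  have := isProbabilityMeasure_expMeasure hσ
  rw [← integral_prod_swap, add_comm ν σ]
  exact integral_discount_sub hσ hν

lemma integral_max_expMeasure :
    ∫ p, max p.1 p.2 ∂((expMeasure ν).prod (expMeasure σ)) =
      1 / σ + σ / (ν + σ) * (1 / ν) := by
  have := isProbabilityMeasure_expMeasure hν
  have := isProbabilityMeasure_expMeasure hσ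
  have hid := integrable_id_expMeasure hν
  have hmax : ∀ p : ℝ × ℝ, max p.1 p.2 = p.2 + max (p.1 - p.2) 0 := fun p => by
    rw [← max_add_add_left, add_sub_cancel, add_zero]
  simp only [hmax]
  rw [integral_add ((integrable_id_expMeasure hσ).comp_snd _)
      (integrable_posPart_sub_prod_expMeasure hν hid measurable_id.stronglyMeasurable hσ),
    integral_posPart_sub_prod_expMeasure hν hid measurable_id.stronglyMeasurable hσ,
    integral_fun_snd (fun x : ℝ => x), integral_id_expMeasure hσ, integral_id_expMeasure hν]
  simp

lemma integral_potential :
    ∫ p, potential ν σ p.1 p.2 ∂((expMeasure ν).prod (expMeasure σ)) = growthRate ν σ := by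
  have := isProbabilityMeasure_expMeasure hν
  have := isProbabilityMeasure_expMeasure hσ
  have hmax : Integrable (fun p : ℝ × ℝ => max p.1 p.2) ((expMeasure ν).prod (expMeasure σ)) :=
    ((integrable_id_expMeasure hν).comp_fst _).sup ((integrable_id_expMeasure hσ).comp_snd _)
  have hdiscount : Integrable (fun p : ℝ × ℝ => discount ν σ (p.1 - p.2))
      ((expMeasure ν).prod (expMeasure σ)) := integrable_discount hν hσ (by fun_prop)
  have hdiscount_swap : Integrable (fun p : ℝ × ℝ => discount σ ν (p.2 - p.1))
      ((expMeasure ν).prod (expMeasure σ)) := integrable_discount hσ hν (by fun_prop)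
  have hsub : Integrable (fun p : ℝ × ℝ => max p.1 p.2 - discount ν σ (p.1 - p.2))
      ((expMeasure ν).prod (expMeasure σ)) := hmax.sub hdiscount
  simp only [potential]
  rw [integral_sub hsub hdiscount_swap, integral_sub hmax hdiscount,
    integral_max_expMeasure hν hσ, integral_discount_sub hν hσ, integral_discount_swap_sub hν hσ]
  simp only [discountLimit, growthRate]
  field_simp
  ring

lemma integral_potential_zero_left :
    ∫ q, potential ν σ 0 q ∂(expMeasure σ) = growthRate ν σ - discountLimit ν σ := by
  have := isProbabilityMeasure_expMeasure hσ
  have hpos : ∀ᵐ q ∂(expMeasure σ), potential ν σ 0 q = q - discount σ ν q := by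
    filter_upwards [ae_pos_expMeasure σ] with q hq
    rw [potential, max_eq_right hq.le, discount_of_nonpos (by linarith)]
    simp only [sub_zero]
  rw [integral_congr_ae hpos, integral_sub (integrable_id_expMeasure hσ)
    (integrable_discount hσ hν (by fun_prop)), integral_id_expMeasure hσ, integral_discount hσ]
  simp only [discountLimit, growthRate]
  field_simp
  ring

lemma integral_potential_posPart_sub {d : ℝ} (hd : 0 ≤ d) :
    ∫ p, potential ν σ (max (p.1 - d) 0) p.2 ∂((expMeasure ν).prod (expMeasure σ)) =
      growthRate ν σ - discount ν σ d := by
  have := isProbabilityMeasure_expMeasure hν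
  have := isProbabilityMeasure_expMeasure hσ
  have hfst := (integrable_id_expMeasure hν).comp_fst (expMeasure σ)
  have hsnd := (integrable_id_expMeasure hσ).comp_snd (expMeasure ν)
  have hF : Integrable (fun t => ∫ q, potential ν σ t q ∂(expMeasure σ)) (expMeasure ν) :=
    (integrable_potential hν hσ hfst hsnd).integral_prod_left
  have hFm : StronglyMeasurable fun t => ∫ q, potential ν σ t q ∂(expMeasure σ) :=
    (continuous_potential ν σ).stronglyMeasurable.integral_prod_right
  have hshift : Integrable (fun p : ℝ × ℝ => max (p.1 - d) 0)
      ((expMeasure ν).prod (expMeasure σ)) := (hfst.sub (integrable_const d)).pos_part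
  rw [integral_prod _ (integrable_potential hν hσ hshift hsnd),
    integral_posPart_sub_expMeasure hν hF hFm hd, integral_potential_zero_left hν hσ,
    ← integral_prod _ (integrable_potential hν hσ hfst hsnd), integral_potential hν hσ,
    discount_of_nonneg hd]
  ring

lemma integral_potential_step_of_le {x y : ℝ} (hxy : y ≤ x) :
    ∫ p, potential ν σ (max x (y + p.1)) (max (x + p.2) y)
      ∂((expMeasure ν).prod (expMeasure σ)) = potential ν σ x y + growthRate ν σ := by
  have := isProbabilityMeasure_expMeasure hν
  have := isProbabilityMeasure_expMeasure hσ
  have hstep : ∀ᵐ p ∂((expMeasure ν).prod (expMeasure σ)),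
      potential ν σ (max x (y + p.1)) (max (x + p.2) y) =
        x + potential ν σ (max (p.1 - (x - y)) 0) p.2 := by
    filter_upwards [Measure.quasiMeasurePreserving_snd.ae (ae_pos_expMeasure σ)] with p hp
    rw [← potential_add_add, ← max_add_add_left, max_eq_left (by linarith : y ≤ x + p.2),
      max_comm, add_zero]
    ring_nf
  have hshift : Integrable (fun p : ℝ × ℝ => max (p.1 - (x - y)) 0)
      ((expMeasure ν).prod (expMeasure σ)) :=
    (((integrable_id_expMeasure hν).comp_fst _).sub (integrable_const _)).pos_part
  rw [integral_congr_ae hstep, integral_add (integrable_const x)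
    (integrable_potential hν hσ hshift ((integrable_id_expMeasure hσ).comp_snd _)),
    integral_potential_posPart_sub hν hσ (sub_nonneg.2 hxy), integral_const, probReal_univ,
    one_smul, potential, max_eq_left hxy, discount_of_nonpos (sub_nonpos.2 hxy)]
  ring

theorem integral_potential_step (x y : ℝ) :
    ∫ p, potential ν σ (max x (y + p.1)) (max (x + p.2) y)
      ∂((expMeasure ν).prod (expMeasure σ)) = potential ν σ x y + growthRate ν σ := by
  rcases le_total y x with hxy | hxy
  · exact integral_potential_step_of_le hν hσ hxy
  · have := isProbabilityMeasure_expMeasure hν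
    have := isProbabilityMeasure_expMeasure hσ
    rw [← integral_prod_swap, potential_swap, growthRate_comm,
      ← integral_potential_step_of_le hσ hν hxy]
    refine integral_congr_ae (ae_of_all _ fun p => ?_)
    simp only [Prod.fst_swap, Prod.snd_swap]
    rw [potential_swap, max_comm, max_comm x]

end Potential

section Independence

variable {Ω E : Type*} [MeasurableSpace Ω] [MeasurableSpace E] {P : Measure Ω} {X Y : ℕ → Ω → E}

lemma indepFun_past_prodMk (hXY : iIndepFun (Sum.elim X Y) P) (hX : ∀ n, AEMeasurable (X n) P)
    (hY : ∀ n, AEMeasurable (Y n) P) (n : ℕ) :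
    IndepFun (fun ω (i : Finset.range n) => (X i ω, Y i ω)) (fun ω => (X n ω, Y n ω)) P := by
  let past : Finset (ℕ ⊕ ℕ) := (Finset.range n).disjSum (Finset.range n)
  let present : Finset (ℕ ⊕ ℕ) := {Sum.inl n, Sum.inr n}
  have hdisj : Disjoint past present := by
    simp [past, present]
  have hpair_past : Measurable fun (v : past → E) (i : Finset.range n) =>
      (v ⟨.inl i, Finset.inl_mem_disjSum.2 i.2⟩, v ⟨.inr i, Finset.inr_mem_disjSum.2 i.2⟩) :=
    measurable_pi_lambda _ fun i =>
      (measurable_pi_apply _).prodMk (measurable_pi_apply _)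
  have hpair_present : Measurable fun v : present → E =>
      (v ⟨.inl n, by simp [present]⟩, v ⟨.inr n, by simp [present]⟩) :=
    (measurable_pi_apply _).prodMk (measurable_pi_apply _)
  exact (hXY.indepFun_finset₀ past present hdisj (Sum.rec hX hY)).comp hpair_past hpair_present

end Independence

section CrossStep

/-- One step `z ↦ A z` of the max-plus system, as a function of the two off-diagonal entries of the
transition matrix `A`. -/
def crossStep (z : Fin 2 → ℝ) (p : ℝ × ℝ) : Fin 2 → ℝ :=
  maxPlusMulVec !![0, p.1; p.2, 0] z

@[simp]
lemma crossStep_zero (z : Fin 2 → ℝ) (p : ℝ × ℝ) : crossStep z p 0 = max (z 0) (z 1 + p.1) := by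
  simp [crossStep, maxPlusMulVec]

@[simp]
lemma crossStep_one (z : Fin 2 → ℝ) (p : ℝ × ℝ) : crossStep z p 1 = max (z 0 + p.2) (z 1) := by
  simp [crossStep, maxPlusMulVec]

lemma measurable_uncurry_crossStep : Measurable (Function.uncurry crossStep) := by
  refine measurable_pi_lambda _ fun i => ?_
  fin_cases i <;> simp only [Function.uncurry, Fin.zero_eta, Fin.mk_one, crossStep_zero,
    crossStep_one] <;> fun_prop

lemma maxPlusState_eq_orbit (b c : ℕ → ℝ) (n : ℕ) :
    maxPlusState (fun k => !![0, b k; c k, 0]) n =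
      orbit crossStep ![0, 0] (fun k => (b k, c k)) n := by
  induction n with
  | zero => rfl
  | succ n ih => rw [maxPlusState, ih, orbit, crossStep]

lemma max_crossStep_sub_max_mem_Icc (z : Fin 2 → ℝ) (p : ℝ × ℝ) :
    max (crossStep z p 0) (crossStep z p 1) - max (z 0) (z 1) ∈ Set.Icc 0 (|p.1| + |p.2|) := by
  have h₁ := le_abs_self p.1
  have h₂ := le_abs_self p.2
  have h₃ := abs_nonneg p.1
  have h₄ := abs_nonneg p.2
  have h₅ := le_max_left (z 0) (z 1)
  have h₆ := le_max_right (z 0) (z 1)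
  rw [crossStep_zero, crossStep_one]
  constructor
  · exact sub_nonneg.2 (max_le_max (le_max_left _ _) (le_max_right _ _))
  · refine sub_le_iff_le_add.2 (max_le (max_le ?_ ?_) (max_le ?_ ?_)) <;> linarith

end CrossStep

section LawOfLargeNumbers

variable {ν σ : ℝ} (hν : 0 < ν) (hσ : 0 < σ)

include hν hσ

theorem isPoissonSolution_potential :
    IsPoissonSolution crossStep ((expMeasure ν).prod (expMeasure σ))
      (fun z => potential ν σ (z 0) (z 1)) (growthRate ν σ)
      (fun p => |p.1| + |p.2| + (discountLimit ν σ + discountLimit σ ν + |growthRate ν σ|)) where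
  measurable := ((continuous_potential ν σ).comp
    (.prodMk (continuous_apply (0 : Fin 2)) (continuous_apply (1 : Fin 2)))).measurable
  memLp_bound := by
    have := isProbabilityMeasure_expMeasure hν
    have := isProbabilityMeasure_expMeasure hσ
    exact (((memLp_id_expMeasure hν).comp_fst _).norm.add
      ((memLp_id_expMeasure hσ).comp_snd _).norm).add (memLp_const _)
  abs_centredIncrement_le z p := by
    obtain ⟨h₁, h₂⟩ := max_crossStep_sub_max_mem_Icc z p
    obtain ⟨h₃, h₄⟩ := max_sub_potential_mem_Icc hν hσ (z 0) (z 1)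
    obtain ⟨h₅, h₆⟩ := max_sub_potential_mem_Icc hν hσ (crossStep z p 0) (crossStep z p 1)
    have hle := le_abs_self (growthRate ν σ)
    have hge := neg_abs_le (growthRate ν σ)
    rw [centredIncrement, abs_le]
    constructor <;> linarith
  integral_eq z := by
    simpa only [crossStep_zero, crossStep_one] using integral_potential_step hν hσ (z 0) (z 1)

variable {Ω : Type*} [MeasurableSpace Ω] {P : Measure Ω} [IsProbabilityMeasure P]
  {β γ : ℕ → Ω → ℝ}

theorem ae_tendsto_potential_div (hβ : ∀ k, HasLaw (β k) (expMeasure ν) P)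
    (hγ : ∀ k, HasLaw (γ k) (expMeasure σ) P) (hindep : iIndepFun (Sum.elim β γ) P)
    (z₀ : Fin 2 → ℝ) :
    ∀ᵐ ω ∂P, Tendsto (fun n : ℕ => potential ν σ
      (orbit crossStep z₀ (fun k => (β k ω, γ k ω)) n 0)
      (orbit crossStep z₀ (fun k => (β k ω, γ k ω)) n 1) / n) atTop (𝓝 (growthRate ν σ)) := by
  have hlaw (n : ℕ) : HasLaw (fun ω => (β n ω, γ n ω))
      ((expMeasure ν).prod (expMeasure σ)) P :=
    IndepFun.hasLaw_prod (hβ n) (hγ n)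
      (hindep.indepFun (Sum.inl_ne_inr : (.inl n : ℕ ⊕ ℕ) ≠ .inr n))
  have hind := indepFun_past_prodMk hindep (fun n => (hβ n).aemeasurable)
    (fun n => (hγ n).aemeasurable)
  have hlimit := ae_tendsto_div_of_isPoissonSolution (z₀ := z₀)
    (isPoissonSolution_potential hν hσ) measurable_uncurry_crossStep hlaw hind
  exact hlimit

lemma tendsto_max_div_of_tendsto_potential_div {x y : ℕ → ℝ} {l : ℝ}
    (h : Tendsto (fun n : ℕ => potential ν σ (x n) (y n) / n) atTop (𝓝 l)) :
    Tendsto (fun n : ℕ => max (x n) (y n) / n) atTop (𝓝 l) := by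
  have hgap : Tendsto (fun n : ℕ => (max (x n) (y n) - potential ν σ (x n) (y n)) / n) atTop
      (𝓝 0) :=
    squeeze_zero
      (fun n => div_nonneg (max_sub_potential_mem_Icc hν hσ (x n) (y n)).1 n.cast_nonneg)
      (fun n => div_le_div_of_nonneg_right (max_sub_potential_mem_Icc hν hσ (x n) (y n)).2
        n.cast_nonneg)
      (tendsto_const_div_atTop_nhds_zero_nat _)
  simpa only [sub_div, add_sub_cancel, add_zero] using h.add hgap

end LawOfLargeNumbers

theorem mainTheorem4 {Ω : Type*} [MeasurableSpace Ω] (P : Measure Ω) [IsProbabilityMeasure P]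
    (ν σ : ℝ) (hν : 0 < ν) (hσ : 0 < σ)
    (β γ : ℕ → Ω → ℝ)
    (hβ : ∀ k, HasLaw (β k) (expMeasure ν) P)
    (hγ : ∀ k, HasLaw (γ k) (expMeasure σ) P)
    (hindep : iIndepFun (Sum.elim β γ) P) :
    IsLyapunovExponent P (fun k ω => !![0, β k ω; γ k ω, 0])
      ((4 * ν ^ 2 + 7 * ν * σ + 4 * σ ^ 2) / (6 * ν * σ * (ν + σ))) := by
  filter_upwards [ae_tendsto_potential_div hν hσ hβ hγ hindep ![0, 0]] with ω hω
  simpa only [maxPlusState_eq_orbit, one_div_mul_eq_div, growthRate] using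
    tendsto_max_div_of_tendsto_potential_div hν hσ hω
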